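/- Let $\mathcal X,\mathcal Y$ be finite non-empty alphabets, let $W(y\,|\,x)$ be transition probabilities from $\mathcal X$ to $\mathcal Y$, and let $K>0$. All logarithms are natural. For a block length $n$, a rate $R\ge 0$ and a codebook $\mathcal C_n$ of $\lfloor e^{nR}\rfloor$ (not necessarily distinct) codewords $\mathbf x_m\in\mathcal X^n$, a channel instance is generated as follows: for each message $m$ a cloud of $\lfloor e^{nK}\rfloor$ sequences in $\mathcal Y^n$ is drawn, all sequences of all clouds being independent, with the $i$-th letter of a sequence in the cloud of $m$ distributed according to $W(\cdot\,|\,x_{m i})$, independently over $i$. The messages are equiprobable; when message $m$ is sent, the channel outputs one of the $\lfloor e^{nK}\rfloor$ (not necessarily distinct) sequences of the cloud of $m$, chosen uniformly. Let $P_e(\mathcal C_n)$ be the error probability of the maximum-likelihood decoder that knows the codebook and the channel instance (ties are broken uniformly at random), averaged over messages, channel instances and channel outputs. The capacity $C(W,K)$ of the channel ensemble is the supremum of the rates $R\ge 0$ for which there is a sequence of codebooks $\mathcal C_n$ of size $\lfloor e^{nR}\rfloor$ with $P_e(\mathcal C_n)\to 0$ as $n\to\infty$. Theorem (Ensemble capacity).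 This supremum is finite, and $$C(W,K)=\max\{\,C(W),\;H_{\max}(W)-K\,\},$$ where $C(W)=\max_P I(P,W)$ is the Shannon capacity of the discrete memoryless channel $W$, with $I(P,W)=\sum_{x,y}P(x)W(y\,|\,x)\log\frac{W(y\,|\,x)}{T(y)}$, and $H_{\max}(W)=\max_P\big\{-\sum_y T(y)\log T(y)\big\}$ is the maximal output entropy, with $T(y)=\sum_x P(x)W(y\,|\,x)$; both maxima are over all probability distributions $P$ on $\mathcal X$. -/

import Mathlib

noncomputable section

namespace CloudChannel

variable {X Y : Type*} [Fintype X] [Fintype Y]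

/-! ### Single-letter quantities (natural logarithms) -/

/-- `W x y = W(y | x)` is a matrix of transition probabilities. -/
def IsTransition (W : X → Y → ℝ) : Prop :=
  ∀ x, W x ∈ stdSimplex ℝ Y

/-- Output distribution `T(y) = ∑ x, P(x) W(y | x)`. -/
def outputDist (P : X → ℝ) (W : X → Y → ℝ) (y : Y) : ℝ :=
  ∑ x, P x * W x y

/-- Entropy `H_T = E_T[-log T(Y)]`. -/
def entropy (T : Y → ℝ) : ℝ :=
  ∑ y, T y * (-Real.log (T y))

/-- Mutual information of input and output under the joint distribution `P(x) W(y | x)`.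
A term with `P(x) W(y | x) = 0` is zero, and otherwise `T(y) > 0`. -/
def mutualInfo (P : X → ℝ) (W : X → Y → ℝ) : ℝ :=
  ∑ x, ∑ y, P x * W x y * Real.log (W x y / outputDist P W y)

/-- Shannon capacity `max_P I(P, W)` of the discrete memoryless channel `W`. -/
def shannonCapacity (W : X → Y → ℝ) : ℝ :=
  sSup ((fun P : X → ℝ => mutualInfo P W) '' stdSimplex ℝ X)

/-- Maximal output entropy `max_P H_T`, with `T` the output distribution of `P`. -/
def maxOutputEntropy (W : X → Y → ℝ) : ℝ :=
  sSup ((fun P : X → ℝ => entropy (outputDist P W)) '' stdSimplex ℝ X)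

/-! ### The maxima are attained -/

theorem continuous_outputDist (W : X → Y → ℝ) :
    Continuous fun P : X → ℝ => outputDist P W := by
  unfold outputDist
  fun_prop

theorem continuous_entropy : Continuous (entropy : (Y → ℝ) → ℝ) := by
  have h : (entropy : (Y → ℝ) → ℝ) = fun T => ∑ y, Real.negMulLog (T y) := by
    funext T
    simp [entropy, Real.negMulLog]
  rw [h]
  have := Real.continuous_negMulLog
  fun_prop

theorem mutualInfo_eq {W : X → Y → ℝ} (hW : IsTransition W) {P : X → ℝ}
    (hP : P ∈ stdSimplex ℝ X) :
    mutualInfo P W = entropy (outputDist P W) - ∑ x, P x * entropy (W x) := by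
  have hterm : ∀ x y, P x * W x y * Real.log (W x y / outputDist P W y)
      = P x * W x y * (-Real.log (outputDist P W y))
        - P x * (W x y * (-Real.log (W x y))) := by
    intro x y
    by_cases h0 : P x * W x y = 0
    · rw [h0, ← mul_assoc, h0]; simp
    · have hw : W x y ≠ 0 := right_ne_zero_of_mul h0
      have hT : 0 < outputDist P W y :=
        lt_of_lt_of_le (lt_of_le_of_ne (mul_nonneg (hP.1 x) ((hW x).1 y)) (Ne.symm h0))
          (Finset.single_le_sum (f := fun x => P x * W x y)
            (fun x _ => mul_nonneg (hP.1 x) ((hW x).1 y)) (Finset.mem_univ x))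
      rw [Real.log_div hw hT.ne']
      ring
  unfold mutualInfo
  simp_rw [hterm, Finset.sum_sub_distrib]
  congr 1
  · rw [Finset.sum_comm]
    simp [entropy, outputDist, Finset.sum_mul]
  · simp [entropy, Finset.mul_sum]

theorem isGreatest_shannonCapacity [Nonempty X] {W : X → Y → ℝ} (hW : IsTransition W) :
    IsGreatest ((fun P : X → ℝ => mutualInfo P W) '' stdSimplex ℝ X) (shannonCapacity W) := by
  classical
  refine IsCompact.isGreatest_sSup ?_ ?_
  · refine (isCompact_stdSimplex ℝ X).image_of_continuousOn ?_
    have h : Continuous fun P : X → ℝ =>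
        entropy (outputDist P W) - ∑ x, P x * entropy (W x) :=
      (continuous_entropy.comp (continuous_outputDist W)).sub (by fun_prop)
    exact h.continuousOn.congr fun P hP => mutualInfo_eq hW hP
  · exact ⟨_, ⟨_, single_mem_stdSimplex ℝ (Classical.arbitrary X), rfl⟩⟩

theorem isGreatest_maxOutputEntropy [Nonempty X] (W : X → Y → ℝ) :
    IsGreatest ((fun P : X → ℝ => entropy (outputDist P W)) '' stdSimplex ℝ X)
      (maxOutputEntropy W) := by
  classical
  refine IsCompact.isGreatest_sSup ?_ ?_
  · exact (isCompact_stdSimplex ℝ X).image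
      (continuous_entropy.comp (continuous_outputDist W))
  · exact ⟨_, ⟨_, single_mem_stdSimplex ℝ (Classical.arbitrary X), rfl⟩⟩

/-! ### The channel ensemble

`M` is the number of messages, `L` the number of sequences in each cloud, `n` the block length.
A codebook is a map `c : Fin M → Fin n → X` (codewords need not be distinct), and a channel
instance is a map `ω : Fin M → Fin L → Fin n → Y`: the cloud of message `m` consists of the
sequences `ω m l`, not necessarily distinct. -/

variable {M L n : ℕ}

/-- Probability of the channel instance `ω` for the codebook `c`: all letters of all sequences of
all clouds are independent, and letter `i` of each sequence in the cloud of `m` has the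
distribution `W(· | c m i)`. -/
def instanceProb (W : X → Y → ℝ) (c : Fin M → Fin n → X) (ω : Fin M → Fin L → Fin n → Y) : ℝ :=
  ∏ m, ∏ l, ∏ i, W (c m i) (ω m l i)

variable [DecidableEq Y]

/-- The channel action: given message `m`, the output is a uniformly chosen element of the cloud
of `m`, so `y` is received with probability (number of replicas of `y` in the cloud) / `L`. -/
def cloudLaw (ω : Fin M → Fin L → Fin n → Y) (m : Fin M) (y : Fin n → Y) : ℝ :=
  ((Finset.univ.filter fun l : Fin L => ω m l = y).card : ℝ) / (L : ℝ)

/-- The messages of maximal likelihood given the received vector `y` and the instance `ω`. -/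
def mlMessages (ω : Fin M → Fin L → Fin n → Y) (y : Fin n → Y) : Finset (Fin M) :=
  Finset.univ.filter fun m => ∀ m', cloudLaw ω m' y ≤ cloudLaw ω m y

/-- Probability that the maximum-likelihood decoder, which knows the codebook and the instance
and breaks ties uniformly at random, outputs `m` when `y` is received. -/
def mlDecode (ω : Fin M → Fin L → Fin n → Y) (y : Fin n → Y) (m : Fin M) : ℝ :=
  if m ∈ mlMessages ω y then 1 / ((mlMessages ω y).card : ℝ) else 0

/-- Error probability of the maximum-likelihood decoder for the instance `ω`, averaged over
equiprobable messages and the channel action. -/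
def instanceError (ω : Fin M → Fin L → Fin n → Y) : ℝ :=
  (1 / (M : ℝ)) * ∑ m, ∑ y, cloudLaw ω m y * (1 - mlDecode ω y m)

/-- `P_e` of the codebook `c` with clouds of size `L`: the error probability of the
maximum-likelihood decoder, averaged over messages and channel instances. -/
def avgError (W : X → Y → ℝ) (L : ℕ) (c : Fin M → Fin n → X) : ℝ :=
  ∑ ω : Fin M → Fin L → Fin n → Y, instanceProb W c ω * instanceError ω

/-- The rates `R ≥ 0` for which some sequence of codebooks of block length `n` and size
`⌊e^{nR}⌋`, used with clouds of size `⌊e^{nK}⌋`, has `P_e → 0`. -/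
def achievableRates (W : X → Y → ℝ) (K : ℝ) : Set ℝ :=
  {R | 0 ≤ R ∧ ∃ c : (n : ℕ) → Fin ⌊Real.exp (n * R)⌋₊ → Fin n → X,
    Filter.Tendsto (fun n : ℕ => avgError W ⌊Real.exp (n * K)⌋₊ (c n)) Filter.atTop (nhds 0)}

/-- Capacity `C(W, K)` of the channel ensemble: the supremum of the achievable rates. -/
def ensembleCapacity (W : X → Y → ℝ) (K : ℝ) : ℝ :=
  sSup (achievableRates W K)

end CloudChannel

end

/-!
For fixed `ω` the maximum-likelihood decoder succeeds with probability
`(1 / M) ∑ y, ⨆ m, cloudLaw ω m y`, and `cloudLaw ω m` is the empirical distribution of the cloud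
of `m`.

Achievability uses random coding with i.i.d. letters of law `P`. By optimality of the decoder it
suffices to exhibit, for each message, a set of accepted outputs which is likely to contain the
received vector and unlikely to contain an independent vector of law `T^n`, where `T` is the output
distribution of `P`. If `R < I(P, W)`, the usual threshold test works. If `R < H_T - K`, accept
the typical members of the cloud itself: there are at most `e^{nK}` of them, each of probability
about `e^{-n H_T}`, so the `e^{nR}` other messages hit them with vanishing probability.

For the converse, group the messages by the type `P` of their codewords. Given the type, the
received vector lies in a set of about `e^{n H_T}` sequences, and there the second moment of the
empirical law of the cloud shows that it hardly exceeds `w + 1 / L`, where `L = e^{nK}` and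
`w` is about `e^{-n H(W | P)}`. So each of the polynomially many types contributes at most about
`e^{n max (I(P, W), H_T - K)}` to `∑ y, ⨆ m, cloudLaw ω m y`.
-/

noncomputable section

namespace CloudChannel

open Filter Finset Real

/-! ### Product distributions -/

section Product

variable {ι U : Type*} [Fintype ι]

/-- The product of the weights `q i`, that is, the joint law of independent letters `u i` with the
laws `q i`. -/
def piWeight (q : ι → U → ℝ) (u : ι → U) : ℝ :=
  ∏ i, q i (u i)

theorem piWeight_eq_exp_neg_sum {q : ι → U → ℝ} {u : ι → U} (hq : ∀ i, 0 < q i (u i)) :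
    piWeight q u = exp (-∑ i, -log (q i (u i))) := by
  rw [sum_neg_distrib, neg_neg, exp_sum]
  exact prod_congr rfl fun i _ => (exp_log (hq i)).symm

variable [DecidableEq ι] [Fintype U] {q : ι → U → ℝ}

theorem sum_piWeight_mul_prod (q g : ι → U → ℝ) :
    ∑ u, piWeight q u * ∏ i, g i (u i) = ∏ i, ∑ a, q i a * g i a := by
  simp only [piWeight, ← prod_mul_distrib]
  rw [prod_univ_sum, Fintype.piFinset_univ]

theorem piWeight_mem_stdSimplex (hq : ∀ i, q i ∈ stdSimplex ℝ U) :
    piWeight q ∈ stdSimplex ℝ (ι → U) :=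
  ⟨fun _ => prod_nonneg fun i _ => (hq i).1 _, by
    simpa [(hq _).2] using sum_piWeight_mul_prod q fun _ _ => 1⟩

theorem sum_piWeight_mul_apply (hq : ∀ i, ∑ a, q i a = 1) (j : ι) (f : U → ℝ) :
    ∑ u, piWeight q u * f (u j) = ∑ a, q j a * f a := by
  have h := sum_piWeight_mul_prod q fun i a => if i = j then f a else 1
  simp only [prod_ite_eq', mem_univ, if_true] at h
  rw [h, prod_eq_single_of_mem j (mem_univ j) fun i _ hi => by simp [hi, hq]]
  simp

theorem sum_piWeight_mul_sum_apply (hq : ∀ i, ∑ a, q i a = 1) (f : ι → U → ℝ) :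
    ∑ u, piWeight q u * ∑ i, f i (u i) = ∑ i, ∑ a, q i a * f i a := by
  simp_rw [mul_sum]
  rw [sum_comm]
  exact sum_congr rfl fun i _ => sum_piWeight_mul_apply hq i (f i)

theorem sum_piWeight_filter_apply_eq_and [DecidableEq U] (hq : ∀ i, ∑ a, q i a = 1) {j k : ι}
    (hjk : j ≠ k) (a b : U) :
    ∑ u with u j = a ∧ u k = b, piWeight q u = q j a * q k b := by
  have h := sum_piWeight_mul_prod q fun i c =>
    (if i = j then if c = a then 1 else 0 else 1) * if i = k then if c = b then 1 else 0 else 1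
  simp only [prod_mul_distrib, prod_ite_eq', mem_univ, if_true] at h
  rw [prod_eq_mul_of_mem j k (mem_univ j) (mem_univ k) hjk fun i _ hi => by simp [hi.1, hi.2, hq]]
    at h
  simpa [sum_filter, hjk, hjk.symm, ite_and, and_comm (a := _ = a)] using h

theorem sum_piWeight_mul_apply_apply (hq : ∀ i, ∑ a, q i a = 1) {j k : ι} (hjk : j ≠ k)
    (f : U → U → ℝ) :
    ∑ u, piWeight q u * f (u j) (u k) = ∑ a, q j a * ∑ b, q k b * f a b := by
  classical
  calc ∑ u, piWeight q u * f (u j) (u k)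
      = ∑ z : U × U, ∑ u with (u j, u k) = z, piWeight q u * f (u j) (u k) :=
        (sum_fiberwise _ _ _).symm
    _ = ∑ z : U × U, (∑ u with u j = z.1 ∧ u k = z.2, piWeight q u) * f z.1 z.2 := by
        refine sum_congr rfl fun z _ => ?_
        rw [sum_mul]
        refine sum_congr (by simp [Prod.ext_iff]) fun u hu => ?_
        obtain ⟨hj, hk⟩ := (mem_filter.1 hu).2
        rw [hj, hk]
    _ = ∑ a, q j a * ∑ b, q k b * f a b := by
        simp_rw [sum_piWeight_filter_apply_eq_and hq hjk, Fintype.sum_prod_type, mul_sum, mul_assoc]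

theorem sum_piWeight_prod {α β : Type*} [Fintype α] [Fintype β] (p : ι → α → ℝ)
    (q : ι → α → β → ℝ) (F : (ι → α) → (ι → β) → ℝ) :
    ∑ u : ι → α × β, piWeight (fun i z => p i z.1 * q i z.1 z.2) u *
        F (fun i => (u i).1) (fun i => (u i).2)
      = ∑ x, piWeight p x * ∑ y, piWeight (fun i => q i (x i)) y * F x y := by
  simp_rw [mul_sum, ← mul_assoc]
  rw [← Fintype.sum_prod_type']
  refine Fintype.sum_equiv (Equiv.arrowProdEquivProdArrow ι (fun _ => α) fun _ => β) _ _
    fun u => ?_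
  simp [piWeight, prod_mul_distrib]

theorem sum_piWeight_mul_sum_sq_le (hq : ∀ i, ∑ a, q i a = 1) (f : ι → U → ℝ) :
    ∑ u, piWeight q u * (∑ i, f i (u i)) ^ 2
      ≤ ∑ i, ∑ a, q i a * f i a ^ 2 + (∑ i, ∑ a, q i a * f i a) ^ 2 := by
  have hterm : ∀ i j, ∑ u, piWeight q u * (f i (u i) * f j (u j))
      ≤ (if i = j then ∑ a, q i a * f i a ^ 2 else 0)
        + (∑ a, q i a * f i a) * ∑ a, q j a * f j a := by
    intro i j
    rcases eq_or_ne i j with rfl | hij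
    · rw [if_pos rfl, sum_piWeight_mul_apply hq i fun a => f i a * f i a]
      simp_rw [← sq]
      exact le_add_of_nonneg_right (sq_nonneg _)
    · rw [if_neg hij, zero_add, sum_piWeight_mul_apply_apply hq hij fun a b => f i a * f j b]
      refine le_of_eq ?_
      simp_rw [sum_mul_sum, mul_sum]
      exact sum_congr rfl fun a _ => sum_congr rfl fun b _ => by ring
  calc ∑ u, piWeight q u * (∑ i, f i (u i)) ^ 2
      = ∑ i, ∑ j, ∑ u, piWeight q u * (f i (u i) * f j (u j)) := by
        simp_rw [sq, sum_mul_sum, mul_sum]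
        rw [sum_comm]
        exact sum_congr rfl fun i _ => sum_comm
    _ ≤ ∑ i, ∑ j, ((if i = j then ∑ a, q i a * f i a ^ 2 else 0)
        + (∑ a, q i a * f i a) * ∑ a, q j a * f j a) :=
        sum_le_sum fun i _ => sum_le_sum fun j _ => hterm i j
    _ = _ := by
        simp_rw [sum_add_distrib, sum_ite_eq, mem_univ, if_true, sq, sum_mul_sum]

theorem sum_mul_sub_mean {p : U → ℝ} (hp : ∑ a, p a = 1) (f : U → ℝ) :
    ∑ a, p a * (f a - ∑ b, p b * f b) = 0 := by
  simp_rw [mul_sub, sum_sub_distrib, ← sum_mul, hp, one_mul, sub_self]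

theorem sum_mul_sub_mean_sq_le {p : U → ℝ} (hp : ∑ a, p a = 1) (f : U → ℝ) :
    ∑ a, p a * (f a - ∑ b, p b * f b) ^ 2 ≤ ∑ a, p a * f a ^ 2 := by
  set μ := ∑ b, p b * f b with hμ
  have hvar : ∑ a, p a * (f a - μ) ^ 2 = ∑ a, p a * f a ^ 2 - μ ^ 2 :=
    calc ∑ a, p a * (f a - μ) ^ 2
        = ∑ a, (p a * f a ^ 2 - 2 * μ * (p a * f a) + μ ^ 2 * p a) :=
          sum_congr rfl fun a _ => by ring
      _ = ∑ a, p a * f a ^ 2 - 2 * μ * μ + μ ^ 2 * 1 := by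
          rw [sum_add_distrib, sum_sub_distrib, ← mul_sum, ← mul_sum, hp, ← hμ]
      _ = _ := by ring
  rw [hvar]
  exact sub_le_self _ (sq_nonneg μ)

theorem sum_piWeight_filter_le_abs_sub_mean_le (hq : ∀ i, q i ∈ stdSimplex ℝ U) (f : ι → U → ℝ)
    {t : ℝ} (ht : 0 < t) :
    ∑ u with t ≤ |∑ i, f i (u i) - ∑ i, ∑ a, q i a * f i a|, piWeight q u
      ≤ (∑ i, ∑ a, q i a * f i a ^ 2) / t ^ 2 := by
  have hq1 : ∀ i, ∑ a, q i a = 1 := fun i => (hq i).2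
  have hw : ∀ u, 0 ≤ piWeight q u := (piWeight_mem_stdSimplex hq).1
  set g : ι → U → ℝ := fun i a => f i a - ∑ b, q i b * f i b with hg
  rw [le_div_iff₀ (by positivity), sum_mul]
  calc ∑ u with t ≤ |∑ i, f i (u i) - ∑ i, ∑ a, q i a * f i a|, piWeight q u * t ^ 2
      ≤ ∑ u with t ≤ |∑ i, f i (u i) - ∑ i, ∑ a, q i a * f i a|,
          piWeight q u * (∑ i, g i (u i)) ^ 2 := by
        refine sum_le_sum fun u hu => mul_le_mul_of_nonneg_left ?_ (hw u)
        rw [hg, sum_sub_distrib, ← sq_abs (_ - _)]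
        exact pow_le_pow_left₀ ht.le (mem_filter.1 hu).2 2
    _ ≤ ∑ u, piWeight q u * (∑ i, g i (u i)) ^ 2 :=
        sum_le_sum_of_subset_of_nonneg (filter_subset _ _)
          fun u _ _ => mul_nonneg (hw u) (sq_nonneg _)
    _ ≤ ∑ i, ∑ a, q i a * g i a ^ 2 + (∑ i, ∑ a, q i a * g i a) ^ 2 :=
        sum_piWeight_mul_sum_sq_le hq1 g
    _ = ∑ i, ∑ a, q i a * g i a ^ 2 := by simp [hg, sum_mul_sub_mean (hq1 _)]
    _ ≤ ∑ i, ∑ a, q i a * f i a ^ 2 := sum_le_sum fun i _ => sum_mul_sub_mean_sq_le (hq1 i) (f i)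

theorem sum_piWeight_mul_average_add_sum_erase {M : ℕ} (hM : 0 < M) {p : U → ℝ}
    (hp : ∑ a, p a = 1) (f : U → ℝ) (g : U → U → ℝ) :
    ∑ u : Fin M → U, piWeight (fun _ => p) u *
        ((1 / (M : ℝ)) * ∑ m, (f (u m) + ∑ m' ∈ univ.erase m, g (u m) (u m')))
      = ∑ a, p a * f a + (M - 1) * ∑ a, p a * ∑ b, p b * g a b := by
  have hM' : (M : ℝ) ≠ 0 := by positivity
  have hp' : ∀ _ : Fin M, ∑ a, p a = 1 := fun _ => hp
  have hterm : ∀ m : Fin M, ∑ u : Fin M → U, piWeight (fun _ => p) u *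
        (f (u m) + ∑ m' ∈ univ.erase m, g (u m) (u m'))
      = ∑ a, p a * f a + (M - 1) * ∑ a, p a * ∑ b, p b * g a b := by
    intro m
    simp_rw [mul_add, sum_add_distrib, mul_sum (univ.erase m)]
    rw [sum_piWeight_mul_apply hp' m f, sum_comm, sum_congr rfl fun m' hm' =>
      sum_piWeight_mul_apply_apply hp' (ne_of_mem_erase hm').symm g, sum_const,
      card_erase_of_mem (mem_univ m), card_univ, Fintype.card_fin, nsmul_eq_mul,
      Nat.cast_pred hM]
  calc _ = (1 / (M : ℝ)) * ∑ m, ∑ u : Fin M → U, piWeight (fun _ => p) u *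
        (f (u m) + ∑ m' ∈ univ.erase m, g (u m) (u m')) := by
        rw [sum_comm, mul_sum]
        exact sum_congr rfl fun u _ => by rw [mul_left_comm, mul_sum]
    _ = _ := by
        simp only [hterm, sum_const, card_univ, Fintype.card_fin, nsmul_eq_mul]
        field_simp

theorem sum_le_sum_add_sum_of_subset_union {β : Type*} [DecidableEq β] {s t u : Finset β}
    {f : β → ℝ} (hf : ∀ b, 0 ≤ f b) (h : s ⊆ t ∪ u) :
    ∑ b ∈ s, f b ≤ ∑ b ∈ t, f b + ∑ b ∈ u, f b := by
  rw [← sum_union_inter]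
  exact le_add_of_le_of_nonneg (sum_le_sum_of_subset_of_nonneg h fun b _ _ => hf b)
    (sum_nonneg fun b _ => hf b)

theorem sum_mul_le_of_forall_le {p : U → ℝ} (hp : p ∈ stdSimplex ℝ U) {f : U → ℝ} {b : ℝ}
    (h : ∀ a, f a ≤ b) : ∑ a, p a * f a ≤ b :=
  (convex_Iic b).sum_mem (fun a _ => hp.1 a) hp.2 fun a _ => h a

theorem exists_le_of_sum_mul_le {p : U → ℝ} (hp : p ∈ stdSimplex ℝ U) {f : U → ℝ} {b : ℝ}
    (h : ∑ a, p a * f a ≤ b) : ∃ a, f a ≤ b := by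
  by_contra! hf
  exact ((convex_Ioi b).sum_mem (fun a _ => hp.1 a) hp.2 fun a _ => hf a).not_ge h

end Product

/-! ### Concentration of products of probabilities -/

section Concentration

variable {U : Type*} [Fintype U] {n : ℕ}

theorem sum_piWeight_filter_notMem_Icc_le {q r : Fin n → U → ℝ} (hq : ∀ i, q i ∈ stdSimplex ℝ U)
    (hqr : ∀ i a, q i a ≠ 0 → 0 < r i a) (hn : 0 < n) {h v δ : ℝ} (hδ : 0 < δ)
    (hh : ∑ i, ∑ a, q i a * -log (r i a) = n * h)
    (hv : ∑ i, ∑ a, q i a * (-log (r i a)) ^ 2 ≤ n * v) :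
    ∑ u with piWeight r u ∉ Set.Icc (exp (-(n * (h + δ)))) (exp (-(n * (h - δ)))), piWeight q u
      ≤ v / δ ^ 2 / n := by
  have hn' : (0 : ℝ) < n := by exact_mod_cast hn
  have hdev : ∀ u, piWeight q u ≠ 0 →
      piWeight r u ∉ Set.Icc (exp (-(n * (h + δ)))) (exp (-(n * (h - δ)))) →
      n * δ ≤ |∑ i, -log (r i (u i)) - n * h| := by
    intro u hu hnot
    contrapose! hnot
    rw [piWeight_eq_exp_neg_sum fun i => hqr i _ (prod_ne_zero_iff.1 hu i (mem_univ i)),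
      Set.mem_Icc, exp_le_exp, exp_le_exp]
    constructor <;> linarith [abs_lt.1 hnot]
  calc ∑ u with piWeight r u ∉ Set.Icc (exp (-(n * (h + δ)))) (exp (-(n * (h - δ)))), piWeight q u
      ≤ ∑ u with n * δ ≤ |∑ i, -log (r i (u i)) - n * h|, piWeight q u := by
        rw [← sum_filter_ne_zero]
        refine sum_le_sum_of_subset_of_nonneg (fun u hu => ?_)
          fun u _ _ => (piWeight_mem_stdSimplex hq).1 u
        simp only [mem_filter, mem_univ, true_and] at hu ⊢
        exact hdev u hu.2 hu.1
    _ ≤ n * v / (n * δ) ^ 2 := by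
        rw [← hh]
        exact (sum_piWeight_filter_le_abs_sub_mean_le hq (fun i a => -log (r i a))
          (mul_pos hn' hδ)).trans (div_le_div_of_nonneg_right hv (sq_nonneg _))
    _ = v / δ ^ 2 / n := by field_simp

theorem mul_log_sq_le {t : ℝ} (h0 : 0 ≤ t) (h1 : t ≤ 1) : t * (-log t) ^ 2 ≤ 4 := by
  rcases h0.eq_or_lt with rfl | hpos
  · simp
  have hsqrt : (log t / 2 * √t) ^ 2 < 1 := by
    rw [← log_sqrt h0, sq_lt_one_iff_abs_lt_one]
    exact abs_log_mul_self_lt _ (sqrt_pos.2 hpos) (sqrt_le_one.2 h1)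
  rw [mul_pow, sq_sqrt h0] at hsqrt
  linarith

theorem sum_mul_log_sq_le {p : U → ℝ} (hp : p ∈ stdSimplex ℝ U) :
    ∑ a, p a * (-log (p a)) ^ 2 ≤ 4 * Fintype.card U := by
  refine (sum_le_sum fun a _ => mul_log_sq_le (hp.1 a) ?_).trans (by simp [mul_comm])
  exact hp.2 ▸ single_le_sum (fun b _ => hp.1 b) (mem_univ a)

theorem sum_piWeight_filter_exp_lt_le {p : U → ℝ} (hp : p ∈ stdSimplex ℝ U) (hn : 0 < n) {δ : ℝ}
    (hδ : 0 < δ) :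
    ∑ u : Fin n → U with exp (-(n * (entropy p - δ))) < piWeight (fun _ => p) u,
        piWeight (fun _ => p) u
      ≤ 4 * Fintype.card U / δ ^ 2 / n := by
  refine (sum_le_sum_of_subset_of_nonneg (monotone_filter_right _ fun u _ hu => ?_)
    fun u _ _ => (piWeight_mem_stdSimplex fun _ => hp).1 u).trans
    (sum_piWeight_filter_notMem_Icc_le (fun _ => hp)
      (fun _ a ha => (hp.1 a).lt_of_ne' ha) hn hδ (h := entropy p) (by simp [entropy]) ?_)
  · exact fun h => h.2.not_gt hu
  · simpa using mul_le_mul_of_nonneg_left (sum_mul_log_sq_le hp) (Nat.cast_nonneg n)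

end Concentration

/-! ### Empirical distributions -/

section Empirical

variable {α : Type*} [DecidableEq α] {k : ℕ}

/-- The distribution of a uniformly chosen entry of `x`: the type of a codeword `x`, or the
channel action on a cloud `x`. -/
def empirical (x : Fin k → α) (a : α) : ℝ :=
  (#{i | x i = a} : ℝ) / k

theorem empirical_nonneg (x : Fin k → α) (a : α) : 0 ≤ empirical x a := by
  unfold empirical
  positivity

theorem empirical_eq_sum_div (x : Fin k → α) (a : α) :
    empirical x a = (∑ i, if x i = a then 1 else 0) / k := by
  rw [empirical, sum_boole]

theorem empirical_apply_pos (x : Fin k → α) (i : Fin k) : 0 < empirical x (x i) := by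
  have hk : 0 < k := i.pos
  have hi : 0 < #{j | x j = x i} := card_pos.2 ⟨i, by simp⟩
  unfold empirical
  positivity

theorem empirical_eq_zero {x : Fin k → α} {a : α} (h : ∀ i, x i ≠ a) : empirical x a = 0 := by
  simp [empirical_eq_sum_div, h]

theorem sum_piWeight_mul_empirical [Fintype α] (hk : 0 < k) {p : α → ℝ} (hp : ∑ a, p a = 1)
    (a : α) : ∑ x : Fin k → α, piWeight (fun _ => p) x * empirical x a = p a := by
  have hk' : (k : ℝ) ≠ 0 := by positivity
  simp_rw [empirical_eq_sum_div, mul_div_assoc', ← sum_div]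
  rw [sum_piWeight_mul_sum_apply (fun _ => hp) fun _ b => if b = a then 1 else 0]
  simp [hk']

theorem sum_piWeight_mul_empirical_sq_le [Fintype α] (hk : 0 < k) {p : α → ℝ}
    (hp : ∑ a, p a = 1) (a : α) :
    ∑ x : Fin k → α, piWeight (fun _ => p) x * empirical x a ^ 2 ≤ p a * (p a + 1 / k) := by
  have h := sum_piWeight_mul_sum_sq_le (ι := Fin k) (fun _ => hp)
    fun _ b => if b = a then (1 : ℝ) else 0
  simp only [ite_pow, one_pow, zero_pow two_ne_zero, mul_ite, mul_one, mul_zero, sum_ite_eq',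
    mem_univ, if_true, sum_const, card_univ, Fintype.card_fin, nsmul_eq_mul] at h
  simp_rw [empirical_eq_sum_div, div_pow, mul_div_assoc', ← sum_div]
  rw [div_le_iff₀ (by positivity)]
  exact h.trans_eq (by field_simp; ring)

theorem sum_empirical_mul [Fintype α] (x : Fin k → α) (f : α → ℝ) :
    ∑ a, empirical x a * f a = (∑ i, f (x i)) / k := by
  simp_rw [empirical_eq_sum_div, div_mul_eq_mul_div, ← sum_div, sum_mul]
  rw [sum_comm]
  simp

theorem empirical_mem_stdSimplex [Fintype α] (hk : 0 < k) (x : Fin k → α) :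
    empirical x ∈ stdSimplex ℝ α := by
  refine ⟨empirical_nonneg x, ?_⟩
  have h := sum_empirical_mul x fun _ => 1
  simpa [hk.ne'] using h

theorem card_image_empirical_le [Fintype α] {ι : Type*} [Fintype ι] (c : ι → Fin k → α) :
    #(univ.image fun m => empirical (c m)) ≤ (k + 1) ^ Fintype.card α := by
  classical
  let count (x : Fin k → α) (a : α) : Fin (k + 1) :=
    ⟨#{i | x i = a}, Nat.lt_succ_of_le ((card_le_univ _).trans_eq (Fintype.card_fin k))⟩
  let ratio (N : α → Fin (k + 1)) (a : α) : ℝ := (N a : ℝ) / k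
  calc #(univ.image fun m => empirical (c m))
      ≤ #(univ.image ratio) :=
        card_le_card fun P hP => by
          obtain ⟨m, -, rfl⟩ := mem_image.1 hP
          exact mem_image.2 ⟨count (c m), mem_univ _, rfl⟩
    _ ≤ (k + 1) ^ Fintype.card α := card_image_le.trans_eq (by simp)

theorem sum_image_empirical_le [Fintype α] {ι : Type*} [Fintype ι] (hk : 0 < k)
    (c : ι → Fin k → α) {f : (α → ℝ) → ℝ} {b : ℝ} (hb : 0 ≤ b)
    (hf : ∀ P ∈ stdSimplex ℝ α, f P ≤ b) :
    ∑ P ∈ univ.image fun m => empirical (c m), f P ≤ ((k : ℝ) + 1) ^ Fintype.card α * b := by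
  have hcard : (#(univ.image fun m => empirical (c m)) : ℝ) ≤ ((k : ℝ) + 1) ^ Fintype.card α := by
    exact_mod_cast card_image_empirical_le c
  refine (sum_le_card_nsmul _ _ b fun P hP => ?_).trans
    ((nsmul_eq_mul _ _).trans_le (mul_le_mul_of_nonneg_right hcard hb))
  obtain ⟨m, -, rfl⟩ := mem_image.1 hP
  exact hf _ (empirical_mem_stdSimplex hk (c m))

end Empirical

/-! ### The channel ensemble -/

section Channel

variable {X Y : Type*} {M L n : ℕ} {W : X → Y → ℝ}

/-- The law `W^n(· | x)` of one sequence of the cloud of the codeword `x`. -/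
def channelLaw (W : X → Y → ℝ) (x : Fin n → X) : (Fin n → Y) → ℝ :=
  piWeight fun i => W (x i)

/-- The law of the whole cloud of the codeword `x`; the cloud size `L` is read off from the
argument. -/
def cloudProb (W : X → Y → ℝ) (x : Fin n → X) : (Fin L → Fin n → Y) → ℝ :=
  piWeight fun _ => channelLaw W x

theorem instanceProb_eq_piWeight (W : X → Y → ℝ) (c : Fin M → Fin n → X) :
    instanceProb (L := L) W c = piWeight fun m => cloudProb W (c m) :=
  rfl

variable [Fintype Y]

theorem isTransition_channelLaw (hW : IsTransition W) : IsTransition (channelLaw (n := n) W) :=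
  fun x => piWeight_mem_stdSimplex fun i => hW (x i)

theorem cloudProb_mem_stdSimplex (hW : IsTransition W) (x : Fin n → X) :
    cloudProb W x ∈ stdSimplex ℝ (Fin L → Fin n → Y) :=
  piWeight_mem_stdSimplex fun _ => isTransition_channelLaw hW x

theorem instanceProb_mem_stdSimplex (hW : IsTransition W) (c : Fin M → Fin n → X) :
    instanceProb W c ∈ stdSimplex ℝ (Fin M → Fin L → Fin n → Y) :=
  piWeight_mem_stdSimplex fun m => cloudProb_mem_stdSimplex hW (c m)

end Channel

section OutputDist

variable {X Y : Type*} [Fintype X] {P : X → ℝ} {W : X → Y → ℝ}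

theorem sum_outputDist_mul [Fintype Y] (P : X → ℝ) (W : X → Y → ℝ) (g : Y → ℝ) :
    ∑ y, outputDist P W y * g y = ∑ x, P x * ∑ y, W x y * g y := by
  simp_rw [outputDist, sum_mul, mul_sum, mul_assoc]
  exact sum_comm

theorem sum_mul_sum_eq_sum_outputDist (P : X → ℝ) (W : X → Y → ℝ) (S : Finset Y) :
    ∑ x, P x * ∑ y ∈ S, W x y = ∑ y ∈ S, outputDist P W y := by
  simp_rw [outputDist, mul_sum]
  exact sum_comm

theorem outputDist_mem_stdSimplex [Fintype Y] (hW : IsTransition W) (hP : P ∈ stdSimplex ℝ X) :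
    outputDist P W ∈ stdSimplex ℝ Y := by
  refine ⟨fun y => sum_nonneg fun x _ => mul_nonneg (hP.1 x) ((hW x).1 y), ?_⟩
  simpa [(hW _).2, hP.2] using sum_outputDist_mul P W fun _ => 1

theorem mul_le_outputDist [Fintype Y] (hW : IsTransition W) (hP : P ∈ stdSimplex ℝ X) (x : X)
    (y : Y) : P x * W x y ≤ outputDist P W y :=
  single_le_sum (f := fun x => P x * W x y) (fun x _ => mul_nonneg (hP.1 x) ((hW x).1 y))
    (mem_univ x)

theorem outputDist_piWeight {n : ℕ} (P : X → ℝ) (W : X → Y → ℝ) (y : Fin n → Y) :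
    outputDist (piWeight fun _ => P) (channelLaw W) y = piWeight (fun _ => outputDist P W) y :=
  sum_piWeight_mul_prod (fun _ => P) fun i x => W x (y i)

end OutputDist

/-! ### Maximum-likelihood decoding -/

theorem sum_mul_sub_sum_erase_le {ι : Type*} [Fintype ι] [DecidableEq ι] {p A : ι → ℝ} {b : ℝ}
    (hp : ∀ m, 0 ≤ p m) (hpb : ∀ m, p m ≤ b) (hb : 0 ≤ b) (hA : ∀ m, 0 ≤ A m)
    (hA1 : ∀ m, A m ≤ 1) :
    ∑ m, p m * (A m - ∑ m' ∈ univ.erase m, A m') ≤ b := by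
  -- `A m ≤ 1` bounds the test `2 * A m - S` by `(2 - S) * A m`, and `(2 - S) * S ≤ 1`.
  set S := ∑ m, A m with hS
  have hS0 : 0 ≤ S := sum_nonneg fun m _ => hA m
  have hpA0 : 0 ≤ ∑ m, p m * A m := sum_nonneg fun m _ => mul_nonneg (hp m) (hA m)
  have hpA : ∑ m, p m * A m ≤ b * S := by
    rw [hS, mul_sum]
    exact sum_le_sum fun m _ => mul_le_mul_of_nonneg_right (hpb m) (hA m)
  calc ∑ m, p m * (A m - ∑ m' ∈ univ.erase m, A m')
      ≤ ∑ m, (2 - S) * (p m * A m) := sum_le_sum fun m _ => by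
        rw [sum_erase_eq_sub (mem_univ m), ← hS]
        nlinarith [mul_nonneg (mul_nonneg (hp m) hS0) (sub_nonneg.2 (hA1 m))]
    _ = (2 - S) * ∑ m, p m * A m := (mul_sum _ _ _).symm
    _ ≤ b := by
        rcases le_total S 2 with h2 | h2
        · nlinarith [mul_le_mul_of_nonneg_left hpA (sub_nonneg.2 h2), sq_nonneg (S - 1)]
        · nlinarith [mul_nonneg hpA0 (sub_nonneg.2 h2)]

section Decoding

variable {X Y : Type*} [DecidableEq Y] {M L n : ℕ} {W : X → Y → ℝ}

theorem cloudLaw_eq_empirical (ω : Fin M → Fin L → Fin n → Y) (m : Fin M) :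
    cloudLaw ω m = empirical (ω m) :=
  rfl

theorem mlDecode_mem_Icc (ω : Fin M → Fin L → Fin n → Y) (y : Fin n → Y) (m : Fin M) :
    mlDecode ω y m ∈ Set.Icc 0 1 := by
  unfold mlDecode
  split_ifs with h
  · have hcard : 1 ≤ #(mlMessages ω y) := card_pos.2 ⟨m, h⟩
    exact ⟨by positivity, div_le_one_of_le₀ (by exact_mod_cast hcard) (by positivity)⟩
  · simp

theorem sum_cloudLaw_mul_mlDecode (hM : 0 < M) (ω : Fin M → Fin L → Fin n → Y) (y : Fin n → Y) :
    ∑ m, cloudLaw ω m y * mlDecode ω y m = ⨆ m, cloudLaw ω m y := by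
  have : Nonempty (Fin M) := ⟨⟨0, hM⟩⟩
  obtain ⟨m₀, hm₀⟩ := exists_eq_ciSup_of_finite (f := fun m => cloudLaw ω m y)
  have hle : ∀ m, cloudLaw ω m y ≤ ⨆ m, cloudLaw ω m y := le_ciSup (Set.finite_range _).bddAbove
  have hmax : ∀ m, m ∈ mlMessages ω y ↔ cloudLaw ω m y = ⨆ m, cloudLaw ω m y := fun m =>
    ⟨fun h => (hle m).antisymm (hm₀ ▸ (mem_filter.1 h).2 m₀),
      fun h => mem_filter.2 ⟨mem_univ m, fun m' => h ▸ hle m'⟩⟩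
  have hcard : (#(mlMessages ω y) : ℝ) ≠ 0 :=
    Nat.cast_ne_zero.2 (card_ne_zero_of_mem ((hmax m₀).2 hm₀))
  calc ∑ m, cloudLaw ω m y * mlDecode ω y m
      = ∑ m ∈ mlMessages ω y, cloudLaw ω m y * (1 / (#(mlMessages ω y) : ℝ)) := by
        simp_rw [mlDecode, mul_ite, mul_zero, sum_ite_mem, univ_inter]
    _ = ∑ m ∈ mlMessages ω y, (⨆ m, cloudLaw ω m y) * (1 / (#(mlMessages ω y) : ℝ)) :=
        sum_congr rfl fun m hm => by rw [(hmax m).1 hm]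
    _ = ⨆ m, cloudLaw ω m y := by
        rw [sum_const, nsmul_eq_mul]
        field_simp

variable [Fintype Y]

theorem cloudLaw_mem_stdSimplex (hL : 0 < L) (ω : Fin M → Fin L → Fin n → Y) (m : Fin M) :
    cloudLaw ω m ∈ stdSimplex ℝ (Fin n → Y) :=
  empirical_mem_stdSimplex hL (ω m)

theorem instanceError_eq (hM : 0 < M) (hL : 0 < L) (ω : Fin M → Fin L → Fin n → Y) :
    instanceError ω = 1 - (1 / (M : ℝ)) * ∑ y, ⨆ m, cloudLaw ω m y := by
  have hM' : (M : ℝ) ≠ 0 := by positivity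
  have hone : ∀ m, ∑ y, cloudLaw ω m y = 1 := fun m => (cloudLaw_mem_stdSimplex hL ω m).2
  simp_rw [instanceError, mul_sub, mul_one, sum_sub_distrib, hone, sum_const, card_univ,
    Fintype.card_fin, nsmul_eq_mul, mul_one]
  rw [sum_comm, sum_congr rfl fun y _ => sum_cloudLaw_mul_mlDecode hM ω y]
  field_simp

theorem instanceError_le (hM : 0 < M) (hL : 0 < L) (ω : Fin M → Fin L → Fin n → Y)
    (A : Fin M → Finset (Fin n → Y)) :
    instanceError ω ≤ (1 / (M : ℝ)) * ∑ m, (∑ y ∈ (A m)ᶜ, cloudLaw ω m y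
      + ∑ m' ∈ univ.erase m, ∑ y ∈ A m', cloudLaw ω m y) := by
  have hM' : (M : ℝ) ≠ 0 := by positivity
  have hone : ∀ m, ∑ y, cloudLaw ω m y = 1 := fun m => (cloudLaw_mem_stdSimplex hL ω m).2
  let ind (m : Fin M) (y : Fin n → Y) : ℝ := if y ∈ A m then 1 else 0
  have hind : ∀ m m', ∑ y ∈ A m', cloudLaw ω m y = ∑ y, cloudLaw ω m y * ind m' y :=
    fun m m' => by simp [ind]
  have hterm : ∀ m, ∑ y ∈ (A m)ᶜ, cloudLaw ω m y + ∑ m' ∈ univ.erase m, ∑ y ∈ A m', cloudLaw ω m y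
      = 1 - ∑ y, cloudLaw ω m y * (ind m y - ∑ m' ∈ univ.erase m, ind m' y) := fun m => by
    rw [← hone m, ← sum_compl_add_sum (A m) (cloudLaw ω m), hind m m]
    simp_rw [hind, mul_sub, sum_sub_distrib, mul_sum]
    rw [sum_comm (s := univ)]
    ring
  have hsup : ∑ m, ∑ y, cloudLaw ω m y * (ind m y - ∑ m' ∈ univ.erase m, ind m' y)
      ≤ ∑ y, ⨆ m, cloudLaw ω m y := by
    rw [sum_comm]
    refine sum_le_sum fun y _ => sum_mul_sub_sum_erase_le
      (fun m => empirical_nonneg _ y) (le_ciSup (Set.finite_range _).bddAbove)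
      (iSup_nonneg fun m => empirical_nonneg _ y) ?_ ?_ <;>
    · intro m
      simp only [ind]
      split_ifs <;> norm_num
  calc instanceError ω = 1 - (1 / (M : ℝ)) * ∑ y, ⨆ m, cloudLaw ω m y := instanceError_eq hM hL ω
    _ ≤ 1 - (1 / (M : ℝ)) *
          ∑ m, ∑ y, cloudLaw ω m y * (ind m y - ∑ m' ∈ univ.erase m, ind m' y) := by gcongr
    _ = _ := by
      simp_rw [hterm, sum_sub_distrib, sum_const, card_univ, Fintype.card_fin, nsmul_eq_mul,
        mul_one, mul_sub]
      field_simp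

theorem instanceError_nonneg (ω : Fin M → Fin L → Fin n → Y) : 0 ≤ instanceError ω :=
  mul_nonneg (by positivity) <| sum_nonneg fun m _ => sum_nonneg fun y _ =>
    mul_nonneg (empirical_nonneg _ y) (sub_nonneg.2 (mlDecode_mem_Icc ω y m).2)

theorem instanceError_eq_zero_of_subsingleton [Subsingleton (Fin M)]
    (ω : Fin M → Fin L → Fin n → Y) : instanceError ω = 0 := by
  have hml : ∀ y m, mlDecode ω y m = 1 := fun y m => by
    have : mlMessages ω y = {m} :=
      eq_singleton_iff_unique_mem.2 ⟨mem_filter.2 ⟨mem_univ m, fun m' => by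
        rw [Subsingleton.elim m' m]⟩, fun m' _ => Subsingleton.elim m' m⟩
    simp [mlDecode, this]
  simp [instanceError, hml]

theorem avgError_nonneg (hW : IsTransition W) (L : ℕ) (c : Fin M → Fin n → X) :
    0 ≤ avgError W L c :=
  sum_nonneg fun ω _ =>
    mul_nonneg ((instanceProb_mem_stdSimplex hW c).1 ω) (instanceError_nonneg ω)

end Decoding

/-! ### Random coding -/

section RandomCoding

variable {X Y : Type*} [Fintype X] [Fintype Y] {M L n : ℕ} {W : X → Y → ℝ} {Q : (Fin n → X) → ℝ}

/-- The joint law of a random codeword with the law `Q` and of its cloud. -/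
def codewordCloudProb (Q : (Fin n → X) → ℝ) (W : X → Y → ℝ)
    (z : (Fin n → X) × (Fin L → Fin n → Y)) : ℝ :=
  Q z.1 * cloudProb W z.1 z.2

theorem sum_codewordCloudProb_mul (Q : (Fin n → X) → ℝ) (W : X → Y → ℝ)
    (f : (Fin n → X) × (Fin L → Fin n → Y) → ℝ) :
    ∑ z, codewordCloudProb Q W z * f z = ∑ x, Q x * ∑ v, cloudProb W x v * f (x, v) := by
  simp_rw [Fintype.sum_prod_type, codewordCloudProb, mul_sum, mul_assoc]

theorem codewordCloudProb_mem_stdSimplex (hW : IsTransition W) (hQ : Q ∈ stdSimplex ℝ (Fin n → X)) :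
    codewordCloudProb Q W ∈ stdSimplex ℝ ((Fin n → X) × (Fin L → Fin n → Y)) := by
  refine ⟨fun z => mul_nonneg (hQ.1 _) ((cloudProb_mem_stdSimplex hW _).1 _), ?_⟩
  simpa [(cloudProb_mem_stdSimplex hW _).2, hQ.2] using
    sum_codewordCloudProb_mul (L := L) Q W fun _ => 1

variable [DecidableEq Y]

theorem sum_codewordCloudProb_mul_sum_empirical (hW : IsTransition W) (hL : 0 < L)
    (Q : (Fin n → X) → ℝ) (S : (Fin n → X) → Finset (Fin n → Y)) :
    ∑ z : (Fin n → X) × (Fin L → Fin n → Y),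
        codewordCloudProb Q W z * ∑ y ∈ S z.1, empirical z.2 y
      = ∑ x, Q x * ∑ y ∈ S x, channelLaw W x y := by
  rw [sum_codewordCloudProb_mul]
  refine sum_congr rfl fun x _ => congrArg (Q x * ·) ?_
  simp_rw [mul_sum]
  rw [sum_comm]
  exact sum_congr rfl fun y _ =>
    sum_piWeight_mul_empirical hL (isTransition_channelLaw hW x).2 y

theorem sum_codewordCloudProb_mul_sum_empirical_const (hW : IsTransition W) (hL : 0 < L)
    (Q : (Fin n → X) → ℝ) (S : Finset (Fin n → Y)) :
    ∑ z : (Fin n → X) × (Fin L → Fin n → Y),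
        codewordCloudProb Q W z * ∑ y ∈ S, empirical z.2 y
      = ∑ y ∈ S, outputDist Q (channelLaw W) y := by
  rw [sum_codewordCloudProb_mul_sum_empirical hW hL Q fun _ => S, sum_mul_sum_eq_sum_outputDist]

theorem sum_piWeight_mul_avgError (Q : (Fin n → X) → ℝ) (W : X → Y → ℝ) :
    ∑ c : Fin M → Fin n → X, piWeight (fun _ => Q) c * avgError W L c
      = ∑ u : Fin M → (Fin n → X) × (Fin L → Fin n → Y),
          piWeight (fun _ => codewordCloudProb Q W) u * instanceError fun m => (u m).2 :=
  (sum_piWeight_prod (fun _ => Q) (fun _ x v => cloudProb W x v)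
    fun _ ω => instanceError ω).symm

theorem exists_avgError_le (hM : 0 < M) (hL : 0 < L) (hW : IsTransition W)
    (hQ : Q ∈ stdSimplex ℝ (Fin n → X))
    (A : (Fin n → X) × (Fin L → Fin n → Y) → Finset (Fin n → Y)) :
    ∃ c : Fin M → Fin n → X, avgError W L c
      ≤ ∑ z, codewordCloudProb Q W z * ∑ y ∈ (A z)ᶜ, empirical z.2 y
        + (M - 1) * ∑ z, codewordCloudProb Q W z * ∑ y ∈ A z, outputDist Q (channelLaw W) y := by
  have hρ := codewordCloudProb_mem_stdSimplex (L := L) hW hQ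
  have hρM := piWeight_mem_stdSimplex fun _ : Fin M => hρ
  refine exists_le_of_sum_mul_le (p := piWeight fun _ => Q)
    (piWeight_mem_stdSimplex fun _ => hQ) ?_
  calc ∑ c : Fin M → Fin n → X, piWeight (fun _ => Q) c * avgError W L c
      = ∑ u : Fin M → (Fin n → X) × (Fin L → Fin n → Y),
          piWeight (fun _ => codewordCloudProb Q W) u * instanceError fun m => (u m).2 :=
        sum_piWeight_mul_avgError Q W
    _ ≤ ∑ u : Fin M → (Fin n → X) × (Fin L → Fin n → Y),
          piWeight (fun _ => codewordCloudProb Q W) u *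
            ((1 / (M : ℝ)) * ∑ m, (∑ y ∈ (A (u m))ᶜ, empirical (u m).2 y
              + ∑ m' ∈ univ.erase m, ∑ y ∈ A (u m'), empirical (u m).2 y)) :=
        sum_le_sum fun u _ => mul_le_mul_of_nonneg_left (by
          simpa only [cloudLaw_eq_empirical] using
            instanceError_le hM hL (fun m => (u m).2) fun m => A (u m)) (hρM.1 u)
    _ = ∑ z, codewordCloudProb Q W z * ∑ y ∈ (A z)ᶜ, empirical z.2 y
        + (M - 1) * ∑ z, codewordCloudProb Q W z *
          ∑ z', codewordCloudProb Q W z' * ∑ y ∈ A z', empirical z.2 y :=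
        sum_piWeight_mul_average_add_sum_erase hM hρ.2
          (fun z => ∑ y ∈ (A z)ᶜ, empirical z.2 y) fun z z' => ∑ y ∈ A z', empirical z.2 y
    _ = _ := by
        congr 2
        simp_rw [mul_sum univ]
        rw [sum_comm]
        refine sum_congr rfl fun z' _ => ?_
        simp_rw [mul_left_comm _ (codewordCloudProb Q W z'), ← mul_sum univ,
          sum_codewordCloudProb_mul_sum_empirical_const hW hL]

end RandomCoding

/-! ### Achievability -/

section Exponents

theorem floor_exp_pos {a : ℝ} (ha : 0 ≤ a) : 0 < ⌊exp a⌋₊ :=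
  Nat.floor_pos.2 (one_le_exp ha)

theorem tendsto_exp_nat_mul_of_neg {a : ℝ} (ha : a < 0) :
    Tendsto (fun n : ℕ => exp (n * a)) atTop (nhds 0) :=
  tendsto_exp_atBot.comp (tendsto_natCast_atTop_atTop.atTop_mul_const_of_neg ha)

theorem one_div_floor_exp_le {a : ℝ} (ha : 0 ≤ a) : 1 / (⌊exp a⌋₊ : ℝ) ≤ 2 * exp (-a) := by
  have hpos : (1 : ℝ) ≤ ⌊exp a⌋₊ := by exact_mod_cast floor_exp_pos ha
  have hlt := Nat.lt_floor_add_one (exp a)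
  rw [div_le_iff₀ (by linarith), exp_neg, mul_assoc, ← div_eq_inv_mul, ← mul_div_assoc,
    le_div_iff₀ (exp_pos a)]
  linarith

end Exponents

section Information

variable {X Y : Type*} [Fintype X] [Fintype Y] {P : X → ℝ} {W : X → Y → ℝ} {δ : ℝ} {n : ℕ}

theorem sum_piWeight_mul_sum_filter_channelLaw_lt_le (hW : IsTransition W)
    (hP : P ∈ stdSimplex ℝ X) (hn : 0 < n) (hδ : 0 < δ) :
    ∑ x : Fin n → X, piWeight (fun _ => P) x *
        ∑ y with channelLaw W x y < exp (-(n * (∑ x, P x * entropy (W x) + δ))), channelLaw W x y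
      ≤ 4 * Fintype.card Y / δ ^ 2 / n := by
  set h := ∑ x, P x * entropy (W x)
  let q (z : X × Y) : ℝ := P z.1 * W z.1 z.2
  have hsum : ∀ g : X → Y → ℝ, ∑ z, q z * g z.1 z.2 = ∑ x, P x * ∑ y, W x y * g x y := fun g => by
    simp_rw [Fintype.sum_prod_type, q, mul_sum, mul_assoc]
  have hq : q ∈ stdSimplex ℝ (X × Y) :=
    ⟨fun z => mul_nonneg (hP.1 _) ((hW _).1 _), by
      simpa [(hW _).2, hP.2] using hsum fun _ _ => 1⟩
  have hmean : ∑ z, q z * -log (W z.1 z.2) = h := hsum fun x y => -log (W x y)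
  have hsq : ∑ z, q z * (-log (W z.1 z.2)) ^ 2 ≤ 4 * Fintype.card Y := by
    rw [hsum fun x y => (-log (W x y)) ^ 2]
    exact sum_mul_le_of_forall_le hP fun x => sum_mul_log_sq_le (hW x)
  have haep := sum_piWeight_filter_notMem_Icc_le (n := n) (q := fun _ => q)
    (r := fun _ z => W z.1 z.2) (fun _ => hq)
    (fun _ z hz => ((hW _).1 _).lt_of_ne' (right_ne_zero_of_mul hz)) hn hδ (h := h)
    (by simp only [hmean, sum_const, card_univ, Fintype.card_fin, nsmul_eq_mul])
    (by simpa using mul_le_mul_of_nonneg_left hsq n.cast_nonneg)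
  refine le_trans ?_ haep
  have hjoint := sum_piWeight_prod (fun _ : Fin n => P) (fun _ x y => W x y) fun x y =>
    if channelLaw W x y < exp (-(n * (h + δ))) then 1 else 0
  simp only [mul_ite, mul_one, mul_zero, ← sum_filter] at hjoint
  refine hjoint.ge.trans (sum_le_sum_of_subset_of_nonneg (monotone_filter_right _ fun u _ hu => ?_)
    fun u _ _ => (piWeight_mem_stdSimplex fun _ => hq).1 u)
  exact fun hu' => hu'.1.not_gt hu

/-- The outputs that a threshold decoder attributes to the codeword `x`: unlikely under the output
law of `P`, but likely when `x` is sent. -/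
def informationTest (P : X → ℝ) (W : X → Y → ℝ) (δ : ℝ) (x : Fin n → X) : Finset (Fin n → Y) :=
  {y | piWeight (fun _ => outputDist P W) y ≤ exp (-(n * (entropy (outputDist P W) - δ))) ∧
    exp (-(n * (∑ x, P x * entropy (W x) + δ))) ≤ channelLaw W x y}

theorem sum_informationTest_le (hW : IsTransition W) (hP : P ∈ stdSimplex ℝ X) (x : Fin n → X) :
    ∑ y ∈ informationTest P W δ x, piWeight (fun _ => outputDist P W) y
      ≤ exp (-(n * (mutualInfo P W - 2 * δ))) := by
  have hx := isTransition_channelLaw hW x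
  set h := ∑ x, P x * entropy (W x) with hh
  calc ∑ y ∈ informationTest P W δ x, piWeight (fun _ => outputDist P W) y
      ≤ ∑ y ∈ informationTest P W δ x,
          exp (-(n * (mutualInfo P W - 2 * δ))) * channelLaw W x y := by
        refine sum_le_sum fun y hy => ?_
        obtain ⟨hT, hx⟩ := (mem_filter.1 hy).2
        calc piWeight (fun _ => outputDist P W) y
            ≤ exp (-(n * (entropy (outputDist P W) - δ))) := hT
          _ = exp (-(n * (mutualInfo P W - 2 * δ))) * exp (-(n * (h + δ))) := by
            rw [← exp_add, mutualInfo_eq hW hP, ← hh]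
            ring_nf
          _ ≤ _ := mul_le_mul_of_nonneg_left hx (exp_pos _).le
    _ ≤ ∑ y, exp (-(n * (mutualInfo P W - 2 * δ))) * channelLaw W x y :=
        sum_le_univ_sum_of_nonneg fun y => mul_nonneg (exp_pos _).le (hx.1 y)
    _ = _ := by rw [← mul_sum, hx.2, mul_one]

theorem sum_piWeight_mul_sum_compl_informationTest_le [DecidableEq Y] (hW : IsTransition W)
    (hP : P ∈ stdSimplex ℝ X) (hn : 0 < n) (hδ : 0 < δ) :
    ∑ x : Fin n → X, piWeight (fun _ => P) x *
        ∑ y ∈ (informationTest P W δ x)ᶜ, channelLaw W x y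
      ≤ 8 * Fintype.card Y / δ ^ 2 / n := by
  set H := entropy (outputDist P W) with hH
  set h := ∑ x, P x * entropy (W x) with hh
  let likely : Finset (Fin n → Y) :=
    {y | exp (-(n * (H - δ))) < piWeight (fun _ => outputDist P W) y}
  let unlikely (x : Fin n → X) : Finset (Fin n → Y) :=
    {y | channelLaw W x y < exp (-(n * (h + δ)))}
  have hcover : ∀ x : Fin n → X, ∑ y ∈ (informationTest P W δ x)ᶜ, channelLaw W x y
      ≤ ∑ y ∈ likely, channelLaw W x y + ∑ y ∈ unlikely x, channelLaw W x y := by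
    intro x
    refine sum_le_sum_add_sum_of_subset_union (isTransition_channelLaw hW x).1 fun y hy => ?_
    simpa [informationTest, likely, unlikely, ← hH, ← hh, imp_iff_not_or] using hy
  calc _ ≤ ∑ x : Fin n → X, piWeight (fun _ => P) x * (∑ y ∈ likely, channelLaw W x y
          + ∑ y ∈ unlikely x, channelLaw W x y) :=
        sum_le_sum fun x _ => mul_le_mul_of_nonneg_left (hcover x)
          ((piWeight_mem_stdSimplex fun _ => hP).1 x)
    _ = ∑ y ∈ likely, piWeight (fun _ => outputDist P W) y
        + ∑ x : Fin n → X, piWeight (fun _ => P) x * ∑ y ∈ unlikely x, channelLaw W x y := by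
        simp_rw [mul_add, sum_add_distrib, sum_mul_sum_eq_sum_outputDist, outputDist_piWeight]
    _ ≤ 4 * Fintype.card Y / δ ^ 2 / n + 4 * Fintype.card Y / δ ^ 2 / n :=
        add_le_add (sum_piWeight_filter_exp_lt_le (outputDist_mem_stdSimplex hW hP) hn hδ)
          (sum_piWeight_mul_sum_filter_channelLaw_lt_le hW hP hn hδ)
    _ = _ := by ring

end Information

section CloudTest

variable {Y : Type*} [Fintype Y] [DecidableEq Y] {L n : ℕ}

/-- The outputs that a decoder knowing the cloud `v` attributes to it: the members of `v`, except
those that are likely under `T` and so tend to occur in other clouds as well. -/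
def cloudTest (T : Y → ℝ) (δ : ℝ) (v : Fin L → Fin n → Y) : Finset (Fin n → Y) :=
  {y ∈ univ.image v | piWeight (fun _ => T) y ≤ exp (-(n * (entropy T - δ)))}

theorem sum_cloudTest_le (T : Y → ℝ) (δ : ℝ) (v : Fin L → Fin n → Y) :
    ∑ y ∈ cloudTest T δ v, piWeight (fun _ => T) y ≤ L * exp (-(n * (entropy T - δ))) := by
  have hcard : #(cloudTest T δ v) ≤ L :=
    (card_filter_le _ _).trans (card_image_le.trans_eq (by simp))
  calc ∑ y ∈ cloudTest T δ v, piWeight (fun _ => T) y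
      ≤ #(cloudTest T δ v) • exp (-(n * (entropy T - δ))) :=
        sum_le_card_nsmul _ _ _ fun y hy => (mem_filter.1 hy).2
    _ ≤ L * exp (-(n * (entropy T - δ))) := by
        rw [nsmul_eq_mul]
        gcongr

theorem sum_compl_cloudTest_le (T : Y → ℝ) (δ : ℝ) (v : Fin L → Fin n → Y) :
    ∑ y ∈ (cloudTest T δ v)ᶜ, empirical v y
      ≤ ∑ y with exp (-(n * (entropy T - δ))) < piWeight (fun _ => T) y, empirical v y := by
  rw [← sum_filter_ne_zero]
  refine sum_le_sum_of_subset_of_nonneg (fun y hy => ?_) fun y _ _ => empirical_nonneg v y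
  obtain ⟨hy, hv⟩ := mem_filter.1 hy
  obtain ⟨l, rfl⟩ : ∃ l, v l = y := by
    by_contra! h
    exact hv (empirical_eq_zero h)
  simpa [cloudTest] using hy

end CloudTest

section Achievability

variable {X Y : Type*} [Fintype X] [Fintype Y] [DecidableEq Y] {P : X → ℝ} {W : X → Y → ℝ}
  {K R δ : ℝ}

theorem mem_achievableRates_of_tests (hW : IsTransition W) (hP : P ∈ stdSimplex ℝ X) (hK : 0 ≤ K)
    (hR : 0 ≤ R) (hδ : 0 < δ) (v : ℝ)
    (A : (n : ℕ) → (Fin n → X) × (Fin ⌊exp (n * K)⌋₊ → Fin n → Y) → Finset (Fin n → Y))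
    (hmiss : ∀ n, 0 < n → ∑ z, codewordCloudProb (piWeight fun _ => P) W z *
      ∑ y ∈ (A n z)ᶜ, empirical z.2 y ≤ v / n)
    (hfalse : ∀ n, 0 < n → ∑ z, codewordCloudProb (piWeight fun _ => P) W z *
      ∑ y ∈ A n z, piWeight (fun _ => outputDist P W) y ≤ exp (-(n * (R + δ)))) :
    R ∈ achievableRates W K := by
  have hcode : ∀ n : ℕ, ∃ c : Fin ⌊exp (n * R)⌋₊ → Fin n → X,
      0 < n → avgError W ⌊exp (n * K)⌋₊ c ≤ v / n + exp (n * -δ) := by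
    intro n
    obtain ⟨c, hc⟩ := exists_avgError_le (floor_exp_pos (a := n * R) (by positivity))
      (floor_exp_pos (a := n * K) (by positivity)) hW (piWeight_mem_stdSimplex fun _ => hP) (A n)
    refine ⟨c, fun hn => hc.trans (add_le_add (hmiss n hn) ?_)⟩
    simp_rw [outputDist_piWeight]
    calc _ ≤ exp (n * R) * exp (-(n * (R + δ))) := by
          refine mul_le_mul ?_ (hfalse n hn) ?_ (exp_pos _).le
          · linarith [Nat.floor_le (exp_pos (n * R)).le]
          · have hρ := codewordCloudProb_mem_stdSimplex hW
              (piWeight_mem_stdSimplex fun _ : Fin n => hP) (L := ⌊exp (n * K)⌋₊)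
            have hT := piWeight_mem_stdSimplex fun _ : Fin n => outputDist_mem_stdSimplex hW hP
            exact sum_nonneg fun z _ => mul_nonneg (hρ.1 z) (sum_nonneg fun y _ => hT.1 y)
      _ = exp (n * -δ) := by rw [← exp_add]; ring_nf
  choose c hc using hcode
  have hlim : Tendsto (fun n : ℕ => v / n + exp (n * -δ)) atTop (nhds 0) := by
    simpa using (tendsto_const_div_atTop_nhds_zero_nat v).add
      (tendsto_exp_nat_mul_of_neg (neg_lt_zero.2 hδ))
  exact ⟨hR, c, squeeze_zero' (Eventually.of_forall fun n => avgError_nonneg hW _ _)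
    ((eventually_gt_atTop 0).mono hc) hlim⟩

theorem mem_achievableRates_of_lt_mutualInfo (hW : IsTransition W) (hP : P ∈ stdSimplex ℝ X)
    (hK : 0 ≤ K) (hR : 0 ≤ R) (hRI : R < mutualInfo P W) : R ∈ achievableRates W K := by
  set δ := (mutualInfo P W - R) / 3 with hδ_def
  have hδ : 0 < δ := by rw [hδ_def]; linarith
  refine mem_achievableRates_of_tests hW hP hK hR hδ (8 * Fintype.card Y / δ ^ 2)
    (fun _ z => informationTest P W δ z.1) (fun n hn => ?_) fun n _ => ?_
  · rw [sum_codewordCloudProb_mul_sum_empirical hW (floor_exp_pos (by positivity)) _ fun x =>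
      (informationTest P W δ x)ᶜ]
    exact sum_piWeight_mul_sum_compl_informationTest_le hW hP hn hδ
  · have hRδ : R + δ = mutualInfo P W - 2 * δ := by rw [hδ_def]; ring
    rw [hRδ]
    have hρ := codewordCloudProb_mem_stdSimplex hW (piWeight_mem_stdSimplex fun _ : Fin n => hP)
      (L := ⌊exp (n * K)⌋₊)
    exact sum_mul_le_of_forall_le hρ fun z => sum_informationTest_le hW hP z.1

theorem mem_achievableRates_of_lt_entropy (hW : IsTransition W) (hP : P ∈ stdSimplex ℝ X)
    (hK : 0 ≤ K) (hR : 0 ≤ R) (hRH : R < entropy (outputDist P W) - K) :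
    R ∈ achievableRates W K := by
  set H := entropy (outputDist P W)
  set δ := (H - K - R) / 2 with hδ_def
  have hδ : 0 < δ := by rw [hδ_def]; linarith
  refine mem_achievableRates_of_tests hW hP hK hR hδ (4 * Fintype.card Y / δ ^ 2)
    (fun _ z => cloudTest (outputDist P W) δ z.2) (fun n hn => ?_) fun n _ => ?_
  · have hρ := codewordCloudProb_mem_stdSimplex hW (piWeight_mem_stdSimplex fun _ : Fin n => hP)
      (L := ⌊exp (n * K)⌋₊)
    refine (sum_le_sum fun z _ =>
      mul_le_mul_of_nonneg_left (sum_compl_cloudTest_le _ δ z.2) (hρ.1 z)).trans ?_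
    rw [sum_codewordCloudProb_mul_sum_empirical_const hW (floor_exp_pos (by positivity))]
    simp_rw [outputDist_piWeight]
    exact sum_piWeight_filter_exp_lt_le (outputDist_mem_stdSimplex hW hP) hn hδ
  · have hρ := codewordCloudProb_mem_stdSimplex hW (piWeight_mem_stdSimplex fun _ : Fin n => hP)
      (L := ⌊exp (n * K)⌋₊)
    have hcloud : ⌊exp (n * K)⌋₊ * exp (-(n * (H - δ))) ≤ exp (-(n * (R + δ))) :=
      calc _ ≤ exp (n * K) * exp (-(n * (H - δ))) := by
            gcongr
            exact Nat.floor_le (exp_pos _).le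
        _ = exp (-(n * (R + δ))) := by
            rw [← exp_add, hδ_def]
            ring_nf
    exact sum_mul_le_of_forall_le hρ fun z => (sum_cloudTest_le _ δ z.2).trans hcloud

end Achievability

/-! ### The converse -/

section Converse

theorem sum_iSup_le {ι κ β : Type*} [Fintype ι] [DecidableEq κ] [Fintype β] [DecidableEq β]
    {f : ι → β → ℝ} (hf : ∀ m y, 0 ≤ f m y) (τ : ι → κ) {G : ι → Finset β} {B : κ → Finset β}
    (hGB : ∀ m, G m ⊆ B (τ m)) {θ : κ → ℝ} (hθ : ∀ t, 0 < θ t) :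
    ∑ y, ⨆ m, f m y ≤ ∑ t ∈ univ.image τ, #(B t) * θ t
      + ∑ m, (∑ y ∈ G m, f m y ^ 2 / θ (τ m) + ∑ y ∈ (G m)ᶜ, f m y) := by
  let base (y : β) (t : κ) : ℝ := if y ∈ B t then θ t else 0
  let excess (y : β) (m : ι) : ℝ := if y ∈ G m then f m y ^ 2 / θ (τ m) else f m y
  have hbase : ∀ y t, 0 ≤ base y t := fun y t => by
    simp only [base]
    split_ifs <;> simp [(hθ t).le]
  have hexcess : ∀ y m, 0 ≤ excess y m := fun y m => by
    simp only [excess]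
    split_ifs
    exacts [div_nonneg (sq_nonneg _) (hθ _).le, hf m y]
  have hle : ∀ y m, f m y ≤ base y (τ m) + excess y m := fun y m => by
    by_cases hy : y ∈ G m
    · simp only [base, excess, hy, hGB m hy, if_true]
      rw [← sub_le_iff_le_add', le_div_iff₀ (hθ _)]
      nlinarith [sq_nonneg (f m y - θ (τ m)), mul_nonneg (hf m y) (hθ (τ m)).le]
    · simpa [excess, hy] using hbase y (τ m)
  have hsup : ∀ y, ⨆ m, f m y ≤ ∑ t ∈ univ.image τ, base y t + ∑ m, excess y m := fun y =>
    Real.iSup_le (fun m => (hle y m).trans (add_le_add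
      (single_le_sum (fun t _ => hbase y t) (mem_image_of_mem τ (mem_univ m)))
      (single_le_sum (fun m _ => hexcess y m) (mem_univ m))))
      (add_nonneg (sum_nonneg fun t _ => hbase y t) (sum_nonneg fun m _ => hexcess y m))
  refine (sum_le_sum fun y _ => hsup y).trans_eq ?_
  rw [sum_add_distrib, sum_comm, sum_comm (f := excess)]
  congr 1
  · simp [base]
  · refine sum_congr rfl fun m _ => ?_
    simp only [excess, sum_ite, filter_mem_eq_inter, univ_inter]
    congr 2
    ext y
    simp

variable {X Y : Type*} [Fintype Y] {W : X → Y → ℝ} {M L n : ℕ}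

theorem sum_instanceProb_mul_apply (hW : IsTransition W) (c : Fin M → Fin n → X) (m : Fin M)
    (F : (Fin L → Fin n → Y) → ℝ) :
    ∑ ω, instanceProb W c ω * F (ω m) = ∑ v, cloudProb W (c m) v * F v := by
  rw [instanceProb_eq_piWeight]
  exact sum_piWeight_mul_apply (fun m => (cloudProb_mem_stdSimplex hW (c m)).2) m F

variable [DecidableEq Y]

theorem one_sub_avgError_eq (hM : 0 < M) (hL : 0 < L) (hW : IsTransition W)
    (c : Fin M → Fin n → X) :
    1 - avgError W L c = (1 / (M : ℝ)) *
      ∑ ω, instanceProb W c ω * ∑ y, ⨆ m, cloudLaw (L := L) ω m y := by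
  simp_rw [avgError, instanceError_eq hM hL, mul_sub, sum_sub_distrib, mul_one,
    (instanceProb_mem_stdSimplex hW c).2, sub_sub_cancel, mul_left_comm _ (1 / (M : ℝ)), ← mul_sum]

theorem sum_cloudProb_mul_excess_le (hL : 0 < L) (hW : IsTransition W) (x : Fin n → X)
    {G : Finset (Fin n → Y)} {w s ε : ℝ} (hw : 0 ≤ w) (hs : 0 < s)
    (hGw : ∀ y ∈ G, channelLaw W x y ≤ w) (hGε : ∑ y ∈ Gᶜ, channelLaw W x y ≤ ε) :
    ∑ v : Fin L → Fin n → Y, cloudProb W x v *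
        (∑ y ∈ G, empirical v y ^ 2 / (s * (w + 1 / L)) + ∑ y ∈ Gᶜ, empirical v y)
      ≤ 1 / s + ε := by
  have hx := isTransition_channelLaw hW x
  have hθ : 0 < s * (w + 1 / L) := mul_pos hs (add_pos_of_nonneg_of_pos hw (by positivity))
  have hsq : ∀ y ∈ G, ∑ v : Fin L → Fin n → Y, cloudProb W x v *
      (empirical v y ^ 2 / (s * (w + 1 / L))) ≤ channelLaw W x y * (1 / s) := fun y hy => by
    simp_rw [mul_div_assoc', ← sum_div]
    rw [div_le_iff₀ hθ]
    calc _ ≤ channelLaw W x y * (channelLaw W x y + 1 / L) :=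
          sum_piWeight_mul_empirical_sq_le hL hx.2 y
      _ ≤ channelLaw W x y * (w + 1 / L) :=
          mul_le_mul_of_nonneg_left (add_le_add_left (hGw y hy) _) (hx.1 y)
      _ = _ := by field_simp
  simp_rw [mul_add (cloudProb W x _), sum_add_distrib, mul_sum]
  rw [sum_comm, sum_comm (t := Gᶜ)]
  refine add_le_add ?_ ?_
  · calc _ ≤ ∑ y ∈ G, channelLaw W x y * (1 / s) := sum_le_sum hsq
      _ ≤ 1 * (1 / s) := by
          rw [← sum_mul]
          exact mul_le_mul_of_nonneg_right
            ((sum_le_univ_sum_of_nonneg hx.1).trans_eq hx.2) (one_div_pos.2 hs).le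
      _ = 1 / s := one_mul _
  · exact (sum_congr rfl fun y _ => sum_piWeight_mul_empirical hL hx.2 y).trans_le hGε

theorem one_sub_avgError_le (hM : 0 < M) (hL : 0 < L) (hW : IsTransition W)
    (c : Fin M → Fin n → X) {κ : Type*} [DecidableEq κ] (τ : Fin M → κ)
    {G : Fin M → Finset (Fin n → Y)} {B : κ → Finset (Fin n → Y)} (hGB : ∀ m, G m ⊆ B (τ m))
    {w : κ → ℝ} (hw : ∀ t, 0 ≤ w t) (hGw : ∀ m, ∀ y ∈ G m, channelLaw W (c m) y ≤ w (τ m))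
    {s ε : ℝ} (hs : 0 < s) (hGε : ∀ m, ∑ y ∈ (G m)ᶜ, channelLaw W (c m) y ≤ ε) :
    1 - avgError W L c
      ≤ s / M * ∑ t ∈ univ.image τ, #(B t) * (w t + 1 / L) + 1 / s + ε := by
  have hM' : (M : ℝ) ≠ 0 := by positivity
  have hinst := instanceProb_mem_stdSimplex (L := L) hW c
  have hθ : ∀ t, 0 < s * (w t + 1 / L) := fun t =>
    mul_pos hs (add_pos_of_nonneg_of_pos (hw t) (by positivity))
  let excess (m : Fin M) (v : Fin L → Fin n → Y) : ℝ :=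
    ∑ y ∈ G m, empirical v y ^ 2 / (s * (w (τ m) + 1 / L)) + ∑ y ∈ (G m)ᶜ, empirical v y
  calc 1 - avgError W L c
      = (1 / (M : ℝ)) * ∑ ω, instanceProb W c ω * ∑ y, ⨆ m, cloudLaw (L := L) ω m y :=
        one_sub_avgError_eq hM hL hW c
    _ ≤ (1 / (M : ℝ)) * ∑ ω, instanceProb W c ω *
          (∑ t ∈ univ.image τ, #(B t) * (s * (w t + 1 / L)) + ∑ m, excess m (ω m)) := by
        refine mul_le_mul_of_nonneg_left (sum_le_sum fun ω _ => mul_le_mul_of_nonneg_left ?_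
          (hinst.1 ω)) (by positivity)
        exact sum_iSup_le (fun m y => empirical_nonneg (ω m) y) τ hGB hθ
    _ = (1 / (M : ℝ)) * (∑ t ∈ univ.image τ, #(B t) * (s * (w t + 1 / L))
          + ∑ m, ∑ v, cloudProb W (c m) v * excess m v) := by
        simp_rw [mul_add (instanceProb W c _), sum_add_distrib, ← sum_mul, hinst.2, one_mul,
          mul_sum _ _ (instanceProb W c _)]
        rw [sum_comm (f := fun ω m => instanceProb W c ω * excess m (ω m))]
        simp_rw [sum_instanceProb_mul_apply hW c]
    _ ≤ (1 / (M : ℝ)) * (∑ t ∈ univ.image τ, #(B t) * (s * (w t + 1 / L))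
          + ∑ _m : Fin M, (1 / s + ε)) := by
        gcongr with m
        exact sum_cloudProb_mul_excess_le hL hW (c m) (hw _) hs (hGw m) (hGε m)
    _ = _ := by
        simp_rw [sum_const, card_univ, Fintype.card_fin, nsmul_eq_mul, mul_left_comm _ s, ← mul_sum]
        generalize ∑ t ∈ univ.image τ, (#(B t) : ℝ) * (w t + 1 / L) = S
        field_simp
        ring

end Converse

section Types

variable {X Y : Type*} [Fintype Y]

/-- The sequences of probability at least `exp (-n (H_T + δ))` under `T`, which are at most
`exp (n (H_T + δ))` in number. -/
def likelyOutputs (T : Y → ℝ) (n : ℕ) (δ : ℝ) : Finset (Fin n → Y) :=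
  {y | exp (-(n * (entropy T + δ))) ≤ piWeight (fun _ => T) y}

theorem card_likelyOutputs_le {T : Y → ℝ} (hT : T ∈ stdSimplex ℝ Y) (n : ℕ) (δ : ℝ) :
    #(likelyOutputs T n δ) ≤ exp (n * (entropy T + δ)) := by
  have hTn := piWeight_mem_stdSimplex fun _ : Fin n => hT
  have h : #(likelyOutputs T n δ) * exp (-(n * (entropy T + δ))) ≤ 1 := by
    rw [← nsmul_eq_mul]
    exact (card_nsmul_le_sum _ _ _ fun y hy => (mem_filter.1 hy).2).trans
      ((sum_le_univ_sum_of_nonneg hTn.1).trans_eq hTn.2)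
  rwa [exp_neg, mul_inv_le_iff₀ (exp_pos _), one_mul] at h

variable [Fintype X] {W : X → Y → ℝ}

theorem card_likelyOutputs_mul_le [Nonempty X] (hW : IsTransition W) {P : X → ℝ}
    (hP : P ∈ stdSimplex ℝ X) {K C : ℝ} (hI : shannonCapacity W ≤ C)
    (hH : maxOutputEntropy W - K ≤ C) (n : ℕ) {δ : ℝ} (hδ : 0 ≤ δ) :
    #(likelyOutputs (outputDist P W) n δ) *
        (exp (-(n * (∑ a, P a * entropy (W a) - δ))) + 2 * exp (-(n * K)))
      ≤ 3 * exp (n * (C + 2 * δ)) := by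
  set H := entropy (outputDist P W) with hH_def
  set h := ∑ a, P a * entropy (W a) with hh_def
  have hHh : H - h ≤ C := by
    rw [hH_def, hh_def, ← mutualInfo_eq hW hP]
    exact ((isGreatest_shannonCapacity hW).2 ⟨P, hP, rfl⟩).trans hI
  have hHK : H - K ≤ C :=
    (sub_le_sub_right ((isGreatest_maxOutputEntropy W).2 ⟨P, hP, rfl⟩) K).trans hH
  calc _ ≤ exp (n * (H + δ)) * (exp (-(n * (h - δ))) + 2 * exp (-(n * K))) := by
        gcongr
        exact card_likelyOutputs_le (outputDist_mem_stdSimplex hW hP) n δ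
    _ = exp (n * (H - h + 2 * δ)) + 2 * exp (n * (H - K + δ)) := by
        rw [mul_add, mul_left_comm, ← exp_add, ← exp_add]
        ring_nf
    _ ≤ exp (n * (C + 2 * δ)) + 2 * exp (n * (C + 2 * δ)) := by
        gcongr
        linarith
    _ = _ := by ring

variable [DecidableEq X] {δ : ℝ} {n : ℕ}

theorem sum_channelLaw_filter_output_notMem_Icc_le (hW : IsTransition W) (hn : 0 < n)
    (hδ : 0 < δ) (x : Fin n → X) :
    ∑ y with piWeight (fun _ => outputDist (empirical x) W) y ∉
        Set.Icc (exp (-(n * (entropy (outputDist (empirical x) W) + δ))))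
          (exp (-(n * (entropy (outputDist (empirical x) W) - δ)))), channelLaw W x y
      ≤ 4 * Fintype.card Y / δ ^ 2 / n := by
  have hP := empirical_mem_stdSimplex hn x
  set T := outputDist (empirical x) W with hT
  have hsum : ∀ g : Y → ℝ, ∑ i, ∑ y, W (x i) y * g y = n * ∑ y, T y * g y := fun g => by
    rw [hT, sum_outputDist_mul, sum_empirical_mul x fun a => ∑ y, W a y * g y]
    field_simp
  refine sum_piWeight_filter_notMem_Icc_le (fun i => hW (x i)) (fun i y hy => ?_) hn hδ
    (hsum _) ((hsum _).trans_le ?_)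
  · exact (mul_pos (empirical_apply_pos x i) (((hW (x i)).1 y).lt_of_ne' hy)).trans_le
      (mul_le_outputDist hW hP (x i) y)
  · exact mul_le_mul_of_nonneg_left (sum_mul_log_sq_le (outputDist_mem_stdSimplex hW hP))
      n.cast_nonneg

theorem sum_channelLaw_filter_notMem_Icc_le (hW : IsTransition W) (hn : 0 < n) (hδ : 0 < δ)
    (x : Fin n → X) :
    ∑ y with channelLaw W x y ∉
        Set.Icc (exp (-(n * (∑ a, empirical x a * entropy (W a) + δ))))
          (exp (-(n * (∑ a, empirical x a * entropy (W a) - δ)))), channelLaw W x y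
      ≤ 4 * Fintype.card Y / δ ^ 2 / n := by
  refine sum_piWeight_filter_notMem_Icc_le (fun i => hW (x i))
    (fun i y hy => ((hW (x i)).1 y).lt_of_ne' hy) hn hδ ?_ ?_
  · rw [sum_empirical_mul]
    simp only [entropy]
    field_simp
  · exact (sum_le_card_nsmul _ _ _ fun i _ => sum_mul_log_sq_le (hW (x i))).trans_eq (by simp)

/-- The outputs of `x` that are likely under the output distribution of the type of `x` and have
no exceptionally large probability when `x` is sent. -/
def typicalOutputs (W : X → Y → ℝ) (δ : ℝ) (x : Fin n → X) : Finset (Fin n → Y) :=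
  {y ∈ likelyOutputs (outputDist (empirical x) W) n δ |
    channelLaw W x y ≤ exp (-(n * (∑ a, empirical x a * entropy (W a) - δ)))}

theorem sum_compl_typicalOutputs_le [DecidableEq Y] (hW : IsTransition W) (hn : 0 < n)
    (hδ : 0 < δ) (x : Fin n → X) :
    ∑ y ∈ (typicalOutputs W δ x)ᶜ, channelLaw W x y ≤ 8 * Fintype.card Y / δ ^ 2 / n := by
  refine (sum_le_sum_add_sum_of_subset_union (isTransition_channelLaw hW x).1
    (fun y hy => ?_)).trans ((add_le_add (sum_channelLaw_filter_output_notMem_Icc_le hW hn hδ x)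
      (sum_channelLaw_filter_notMem_Icc_le hW hn hδ x)).trans_eq (by ring))
  contrapose! hy
  simp only [mem_union, mem_filter, mem_univ, true_and, not_or, not_not] at hy
  simpa [typicalOutputs, likelyOutputs] using ⟨hy.1.1, hy.2.2⟩

end Types

section Capacity

theorem tendsto_succ_pow_mul_exp_neg (k : ℕ) {δ : ℝ} (hδ : 0 < δ) :
    Tendsto (fun n : ℕ => ((n : ℝ) + 1) ^ k * exp (n * -δ)) atTop (nhds 0) := by
  have h := tendsto_pow_const_mul_const_pow_of_abs_lt_one k (r := exp (-δ))
    (by rwa [abs_exp, exp_lt_one_iff, neg_lt_zero])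
  have h' := ((tendsto_add_atTop_iff_nat 1).2 h).mul_const (exp δ)
  rw [zero_mul] at h'
  refine h'.congr fun n => ?_
  rw [mul_assoc, ← exp_nat_mul, ← exp_add]
  push_cast
  ring_nf

variable {X Y : Type*} [Fintype X] [Nonempty X] [Fintype Y] [DecidableEq Y] {W : X → Y → ℝ}
  {K R : ℝ}

theorem one_sub_avgError_floor_exp_le (hW : IsTransition W) (hK : 0 ≤ K) (hR : 0 ≤ R) {C δ : ℝ}
    (hδ : 0 < δ) (hI : shannonCapacity W ≤ C) (hH : maxOutputEntropy W - K ≤ C) {n : ℕ}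
    (hn : 0 < n) (c : Fin ⌊exp (n * R)⌋₊ → Fin n → X) :
    1 - avgError W ⌊exp (n * K)⌋₊ c
      ≤ 6 * (((n : ℝ) + 1) ^ Fintype.card X * exp (n * (C + 3 * δ - R)))
        + exp (n * -δ) + 8 * Fintype.card Y / δ ^ 2 / n := by
  classical
  have hnK : 0 ≤ n * K := by positivity
  have hnR : 0 ≤ n * R := by positivity
  let w (P : X → ℝ) : ℝ := exp (-(n * (∑ a, P a * entropy (W a) - δ)))
  let B (P : X → ℝ) : Finset (Fin n → Y) := likelyOutputs (outputDist P W) n δ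
  have htypes : ∑ P ∈ univ.image fun m => empirical (c m),
      #(B P) * (w P + 1 / (⌊exp (n * K)⌋₊ : ℝ))
        ≤ ((n : ℝ) + 1) ^ Fintype.card X * (3 * exp (n * (C + 2 * δ))) :=
    sum_image_empirical_le hn c (by positivity) fun P hP =>
      (mul_le_mul_of_nonneg_left (add_le_add_right (one_div_floor_exp_le hnK) _)
        (Nat.cast_nonneg _)).trans (card_likelyOutputs_mul_le hW hP hI hH n hδ.le)
  have hexp : exp (n * (C + 3 * δ - R))
      = exp (n * δ) * exp (-(n * R)) * exp (n * (C + 2 * δ)) := by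
    rw [← exp_add, ← exp_add]
    ring_nf
  calc 1 - avgError W ⌊exp (n * K)⌋₊ c
      ≤ exp (n * δ) / ⌊exp (n * R)⌋₊ * ∑ P ∈ univ.image fun m => empirical (c m),
          #(B P) * (w P + 1 / (⌊exp (n * K)⌋₊ : ℝ))
        + 1 / exp (n * δ) + 8 * Fintype.card Y / δ ^ 2 / n :=
        one_sub_avgError_le (floor_exp_pos hnR) (floor_exp_pos hnK) hW c
          (fun m => empirical (c m)) (G := fun m => typicalOutputs W δ (c m))
          (fun m => filter_subset _ _) (fun P => (exp_pos _).le)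
          (fun m y hy => (mem_filter.1 hy).2) (exp_pos (n * δ))
          fun m => sum_compl_typicalOutputs_le hW hn hδ (c m)
    _ ≤ exp (n * δ) * (2 * exp (-(n * R)))
          * (((n : ℝ) + 1) ^ Fintype.card X * (3 * exp (n * (C + 2 * δ))))
        + 1 / exp (n * δ) + 8 * Fintype.card Y / δ ^ 2 / n := by
        rw [div_eq_mul_one_div (exp (n * δ))]
        gcongr ?_ + _ + _
        refine mul_le_mul (mul_le_mul_of_nonneg_left (one_div_floor_exp_le hnR) (exp_pos _).le)
          htypes (sum_nonneg fun P _ => ?_) (by positivity)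
        exact mul_nonneg (Nat.cast_nonneg _) (add_nonneg (exp_pos _).le (by positivity))
    _ = _ := by
        rw [hexp, mul_neg, exp_neg (n * δ), one_div]
        ring

theorem le_of_mem_achievableRates (hW : IsTransition W) (hK : 0 ≤ K)
    (h : R ∈ achievableRates W K) :
    R ≤ max (shannonCapacity W) (maxOutputEntropy W - K) := by
  obtain ⟨hR, c, hc⟩ := h
  set C := max (shannonCapacity W) (maxOutputEntropy W - K)
  by_contra! hlt
  set δ := (R - C) / 4 with hδ_def
  have hδ : 0 < δ := by rw [hδ_def]; linarith
  have hrate : C + 3 * δ - R = -δ := by rw [hδ_def]; ring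
  have hlim : Tendsto (fun n : ℕ => 6 * (((n : ℝ) + 1) ^ Fintype.card X * exp (n * -δ))
      + exp (n * -δ) + 8 * Fintype.card Y / δ ^ 2 / n) atTop (nhds 0) := by
    simpa using (((tendsto_succ_pow_mul_exp_neg (Fintype.card X) hδ).const_mul 6).add
      (tendsto_exp_nat_mul_of_neg (neg_lt_zero.2 hδ))).add
      (tendsto_const_div_atTop_nhds_zero_nat (8 * Fintype.card Y / δ ^ 2))
  have hle : (1 : ℝ) - 0 ≤ 0 := le_of_tendsto_of_tendsto (hc.const_sub 1) hlim <| by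
    filter_upwards [eventually_gt_atTop 0] with n hn
    have h := one_sub_avgError_floor_exp_le hW hK hR hδ (C := C) (le_max_left _ _)
      (le_max_right _ _) hn (c n)
    rwa [hrate] at h
  linarith

omit [Fintype X] in
theorem zero_mem_achievableRates (W : X → Y → ℝ) (K : ℝ) : 0 ∈ achievableRates W K := by
  refine ⟨le_rfl, fun _ _ _ => Classical.arbitrary X, tendsto_const_nhds.congr fun n => ?_⟩
  have : Subsingleton (Fin ⌊exp (n * (0 : ℝ))⌋₊) := by
    rw [mul_zero, exp_zero, Nat.floor_one]
    infer_instance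
  simp [avgError, instanceError_eq_zero_of_subsingleton]

theorem isLUB_achievableRates (hW : IsTransition W) (hK : 0 ≤ K) :
    IsLUB (achievableRates W K) (max (shannonCapacity W) (maxOutputEntropy W - K)) := by
  refine ⟨fun R hR => le_of_mem_achievableRates hW hK hR, fun b hb => ?_⟩
  refine le_of_forall_lt_imp_le_of_dense fun R hR => ?_
  rcases le_total R 0 with hR0 | hR0
  · exact hR0.trans (hb (zero_mem_achievableRates W K))
  refine hb ?_
  rcases lt_max_iff.1 hR with hRI | hRH
  · obtain ⟨P, hP, hPI⟩ := (isGreatest_shannonCapacity hW).1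
    exact mem_achievableRates_of_lt_mutualInfo hW hP hK hR0 (hRI.trans_eq hPI.symm)
  · obtain ⟨P, hP, hPH⟩ := (isGreatest_maxOutputEntropy W).1
    exact mem_achievableRates_of_lt_entropy hW hP hK hR0
      (hRH.trans_eq (congrArg (· - K) hPH.symm))

end Capacity

end CloudChannel

end

theorem theorem3 {X Y : Type*} [Fintype X] [Nonempty X] [Fintype Y] [DecidableEq Y]
    (W : X → Y → ℝ) (hW : CloudChannel.IsTransition W) (K : ℝ) (hK : 0 < K) :
    IsLUB (CloudChannel.achievableRates W K) (CloudChannel.ensembleCapacity W K) ∧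
    CloudChannel.ensembleCapacity W K =
      max (CloudChannel.shannonCapacity W) (CloudChannel.maxOutputEntropy W - K) := by
  have hlub := CloudChannel.isLUB_achievableRates hW hK.le
  have hcap : CloudChannel.ensembleCapacity W K =
      max (CloudChannel.shannonCapacity W) (CloudChannel.maxOutputEntropy W - K) :=
    hlub.csSup_eq ⟨0, CloudChannel.zero_mem_achievableRates W K⟩
  exact ⟨hcap ▸ hlub, hcap⟩
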